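/- Let $\widehat{\mathbb C}=\mathbb C\cup\{\infty\}$, identified with the unit sphere $S^2\subset\mathbb R^3$ by stereographic projection from the north pole, and for $\alpha\subseteq\widehat{\mathbb C}$ let $\mathcal A_\alpha$ be the group of linear fractional transformations $f$ with $f(\alpha)=\alpha$. Say that a set is a union from a collection if it is a union of certain elements of that collection. Let $n\ge 2$, $G=\langle z\mapsto e^{2\pi i/n}z\rangle$, and for $k\ge 1$, $z\in\mathbb C^*$ put $C_k(z)=\{e^{2\pi i j/k}z : j\in\mathbb Z\}$. Then $G\simeq\mathbb Z_n$; for all $p\ge 2$ and $z\in\mathbb C^*$, $$C_{pn}(z)=C_n(z)\cup C_n(e^{\frac{1}{pn}2\pi i}z)\cup\cdots\cup C_n(e^{\frac{p-1}{pn}2\pi i}z);$$ and for every finite $\alpha\subseteq\widehat{\mathbb C}$ with $|\alpha|\ge 4$, one has $\mathcal A_\alpha=G$ if and only if all of the following hold: 1. $\alpha$ is a union from $\{\{\infty\},\{0\}\}\cup\{C_n(z) : z\in\mathbb C^*\}$; 2. for no $p\ge 2$ is $\alpha$ a union from $\{\{\infty\},\{0\}\}\cup\{C_{pn}(z) : z\in\mathbb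 C^*\}$; 3. $\alpha$ is not in the icosahedral, the octahedral, the tetrahedral or the dihedral case. Here $\alpha$ is in the icosahedral (respectively octahedral, tetrahedral) case if for some linear fractional transformation $\psi$ the set $\psi(\alpha)$ is a union from $\{V,F,E\}\cup\{B(X) : X\in S^2\setminus(V\cup F\cup E)\}$, where $V,F,E\subset S^2$ are the central projections of the vertices, of the centres of the faces and of the midpoints of the edges of a fixed regular dodecahedron (respectively cube, regular tetrahedron) centred at the origin, and $B(X)$ is the orbit of $X$ under the group of rotations about the origin preserving that polyhedron. And $\alpha$ is in the dihedral case if for some $m\ge 2$ and some linear fractional transformation $\psi$ the set $\psi(\alpha)$ is a union from the collection consisting of $\{0,\infty\}$, $A_m=\{e^{2\pi i k/m} : k\in\mathbb Z\}$, $B_m=\{e^{2\pi i(2k+1)/(2m)} : k\in\mathbb Z\}$, and the sets $\{z e^{2\pi i k/m} : k\in\mathbb Z\}\cup\{z^{-1}e^{2\pi i k/m} : k\in\mathbb Z\}$ for $z\in\mathbb C^*$ not of the form $e^{2\pi i l/(2m)}$ with $l\in\mathbb Z$. -/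

import Mathlib

open OnePoint Matrix
open scoped Pointwise

noncomputable section

namespace MobiusStab

/-! ### Linear fractional transformations of the Riemann sphere `ℂ ∪ {∞}` -/

/-- The group of linear fractional transformations of the Riemann sphere, as permutations:
the transformations `z ↦ (a z + b) / (c z + d)` with `a d - b c ≠ 0`. -/
def linFrac : Subgroup (Equiv.Perm (OnePoint ℂ)) :=
  (MulAction.toPermHom (GL (Fin 2) ℂ) (OnePoint ℂ)).range

/-- The group of linear fractional transformations `f` with `f(α) = α`. -/
def fixGroup (α : Set (OnePoint ℂ)) : Subgroup (Equiv.Perm (OnePoint ℂ)) :=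
  linFrac ⊓ MulAction.stabilizer (Equiv.Perm (OnePoint ℂ)) α

/-- The number `e ^ (2 π i x)`. -/
def expTurn (x : ℝ) : ℂ := Complex.exp (x * (2 * Real.pi * Complex.I))

/-- The transformation `z ↦ e ^ (2 π i / n) z`, with `∞ ↦ ∞`. -/
def rot (n : ℕ) : Equiv.Perm (OnePoint ℂ) :=
  ((Homeomorph.mulLeft₀ (expTurn (1 / n)) (Complex.exp_ne_zero _)).onePointCongr).toEquiv

/-- The cyclic group generated by `z ↦ e ^ (2 π i / n) z`. -/
def rotGroup (n : ℕ) : Subgroup (Equiv.Perm (OnePoint ℂ)) :=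
  Subgroup.closure {rot n}

/-- `S` is a union of certain elements of the collection `cells`. -/
def IsUnionOf {X : Type} (cells : Set (Set X)) (S : Set X) : Prop :=
  ∃ T ⊆ cells, S = ⋃₀ T

/-! ### The cyclic case -/

/-- `C_n(z) = {e ^ (2 π i k / n) z | k ∈ ℤ}`. -/
def cyclicOrbit (n : ℕ) (z : ℂ) : Set (OnePoint ℂ) :=
  {w | ∃ k : ℤ, w = ((expTurn (k / n) * z : ℂ) : OnePoint ℂ)}

/-- The collection `{{∞}, {0}} ∪ {C_n(z) | z ∈ ℂ*}`. -/
def cyclicCells (n : ℕ) : Set (Set (OnePoint ℂ)) :=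
  {{∞}, {((0 : ℂ) : OnePoint ℂ)}} ∪ {S | ∃ z : ℂ, z ≠ 0 ∧ S = cyclicOrbit n z}

/-! ### The dihedral case -/

/-- `A_m = {e ^ (2 π i k / m) | k ∈ ℤ}`. -/
def dihedralA (m : ℕ) : Set (OnePoint ℂ) :=
  {w | ∃ k : ℤ, w = (expTurn (k / m) : OnePoint ℂ)}

/-- `B_m = {e ^ (2 π i (2 k + 1) / (2 m)) | k ∈ ℤ}`. -/
def dihedralB (m : ℕ) : Set (OnePoint ℂ) :=
  {w | ∃ k : ℤ, w = (expTurn ((2 * k + 1) / (2 * m)) : OnePoint ℂ)}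

/-- `{z e ^ (2 π i k / m) | k ∈ ℤ} ∪ {z⁻¹ e ^ (2 π i k / m) | k ∈ ℤ}`. -/
def dihedralC (m : ℕ) (z : ℂ) : Set (OnePoint ℂ) :=
  {w | ∃ k : ℤ, w = ((z * expTurn (k / m) : ℂ) : OnePoint ℂ)} ∪
    {w | ∃ k : ℤ, w = ((z⁻¹ * expTurn (k / m) : ℂ) : OnePoint ℂ)}

/-- The orbits of the dihedral group `⟨z ↦ e ^ (2 π i / m) z, z ↦ 1 / z⟩`: the sets `{0, ∞}`,
`A_m`, `B_m`, and `C_m(z)` for `z ∈ ℂ*` not of the form `e ^ (2 π i l / (2 m))`, `l ∈ ℤ`. -/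
def dihedralCells (m : ℕ) : Set (Set (OnePoint ℂ)) :=
  {{((0 : ℂ) : OnePoint ℂ), ∞}, dihedralA m, dihedralB m} ∪
    {S | ∃ z : ℂ, z ≠ 0 ∧ (∀ l : ℤ, z ≠ expTurn (l / (2 * m))) ∧ S = dihedralC m z}

/-- `α` is in the dihedral case: for some `m ≥ 2`, a linear fractional transformation carries `α`
to a union of orbits of the dihedral group of order `2 m`. -/
def DihedralCase (α : Set (OnePoint ℂ)) : Prop :=
  ∃ m : ℕ, 2 ≤ m ∧ ∃ ψ ∈ linFrac, IsUnionOf (dihedralCells m) (ψ '' α)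

/-! ### The polyhedral cases

Vectors of `ℝ³` are functions `Fin 3 → ℝ` with the dot product `⬝ᵥ`. A convex polyhedron is given
by its set `P` of vertices. -/

/-- The unit sphere `S²`. -/
def sphere2 : Set (Fin 3 → ℝ) := {x | x ⬝ᵥ x = 1}

/-- Central projection `x ↦ x / |x|` of `ℝ³ \ {0}` onto the unit sphere. -/
def centralProj (x : Fin 3 → ℝ) : Fin 3 → ℝ := (Real.sqrt (x ⬝ᵥ x))⁻¹ • x

/-- Stereographic projection of the unit sphere from the north pole `(0, 0, 1)`, which is sent to
`∞`. It identifies `S²` with the Riemann sphere. -/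
def stereo (x : Fin 3 → ℝ) : OnePoint ℂ :=
  if x 2 = 1 then ∞ else (((x 0 + x 1 * Complex.I) / (1 - x 2) : ℂ) : OnePoint ℂ)

/-- `F` is the set of those vertices of the polyhedron that lie on some supporting plane
`{x | u ⬝ᵥ x = c}`. -/
def IsSupported (P : Set (Fin 3 → ℝ)) (F : Finset (Fin 3 → ℝ)) : Prop :=
  ∃ (u : Fin 3 → ℝ) (c : ℝ), u ≠ 0 ∧ (∀ v ∈ P, u ⬝ᵥ v ≤ c) ∧
    (F : Set (Fin 3 → ℝ)) = {v | v ∈ P ∧ u ⬝ᵥ v = c}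

/-- The mean of a finite set of points. -/
def mean (F : Finset (Fin 3 → ℝ)) : Fin 3 → ℝ := (F.card : ℝ)⁻¹ • ∑ v ∈ F, v

/-- The central projections of the vertices. -/
def vertexPts (P : Set (Fin 3 → ℝ)) : Set (Fin 3 → ℝ) := centralProj '' P

/-- The central projections of the centres of the faces (a face is cut out by a supporting plane
that contains at least three vertices). -/
def facePts (P : Set (Fin 3 → ℝ)) : Set (Fin 3 → ℝ) :=
  {x | ∃ F : Finset (Fin 3 → ℝ), IsSupported P F ∧ 3 ≤ F.card ∧ x = centralProj (mean F)}

/-- The central projections of the midpoints of the edges (an edge is cut out by a supporting plane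
that contains exactly two vertices). -/
def edgePts (P : Set (Fin 3 → ℝ)) : Set (Fin 3 → ℝ) :=
  {x | ∃ F : Finset (Fin 3 → ℝ), IsSupported P F ∧ F.card = 2 ∧ x = centralProj (mean F)}

/-- The orbit of `X` under the group of rotations about the origin that carry the polyhedron with
vertex set `P` into itself. -/
def rotationOrbit (P : Set (Fin 3 → ℝ)) (X : Fin 3 → ℝ) : Set (Fin 3 → ℝ) :=
  {Y | ∃ R ∈ specialOrthogonalGroup (Fin 3) ℝ, (fun v => R *ᵥ v) '' P = P ∧ Y = R *ᵥ X}

/-- The collection `{V, F, E} ∪ {B(X) | X ∈ S² \ (V ∪ F ∪ E)}` of subsets of the sphere. -/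
def polyhedralCells (P : Set (Fin 3 → ℝ)) : Set (Set (Fin 3 → ℝ)) :=
  {vertexPts P, facePts P, edgePts P} ∪
    {S | ∃ X ∈ sphere2 \ (vertexPts P ∪ facePts P ∪ edgePts P), S = rotationOrbit P X}

/-- Up to a linear fractional transformation, `α` is (under stereographic projection) a union of
certain elements of `{V, F, E} ∪ {B(X)}`. -/
def PolyhedralCase (P : Set (Fin 3 → ℝ)) (α : Set (OnePoint ℂ)) : Prop :=
  ∃ ψ ∈ linFrac, ∃ S, IsUnionOf (polyhedralCells P) S ∧ ψ '' α = stereo '' S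

/-- The vertices of a regular tetrahedron centred at the origin. -/
def tetrahedron : Set (Fin 3 → ℝ) :=
  {![1, 1, 1], ![1, -1, -1], ![-1, 1, -1], ![-1, -1, 1]}

/-- The vertices of a cube centred at the origin. -/
def cube : Set (Fin 3 → ℝ) := {v | ∀ i, v i = 1 ∨ v i = -1}

/-- The vertices of a regular dodecahedron centred at the origin: `(±1, ±1, ±1)` and the cyclic
permutations of `(0, ±φ⁻¹, ±φ)`, where `φ` is the golden ratio. -/
def dodecahedron : Set (Fin 3 → ℝ) :=
  cube ∪ {v | ∃ a b : ℝ, (a = 1 ∨ a = -1) ∧ (b = 1 ∨ b = -1) ∧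
    (v = ![0, a * Real.goldenRatio⁻¹, b * Real.goldenRatio] ∨
      v = ![a * Real.goldenRatio⁻¹, b * Real.goldenRatio, 0] ∨
      v = ![b * Real.goldenRatio, 0, a * Real.goldenRatio⁻¹])}

end MobiusStab

end

noncomputable section

namespace MobiusStab

/-! ### Similarities and the inversion -/

/-! The classification of finite rotation groups is replaced by an analysis of involutions. A linear
fractional map with three fixed points is the identity, so the stabilizer Γ of `α` acts faithfully
on `α` and is finite. Being a union of cells amounts to invariance under the group concerned, so
condition 1 says that Γ contains `rotGroup n`.

If Γ has two distinct involutions s and t, then st is conjugate to a scaling and s conjugates it to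
its inverse; after a further scaling s becomes z ↦ 1/z, and `α` is in the dihedral case
(`exists_conj_dihedral`, `dihedralCase_of_conj_mem`). Otherwise Γ has at most one involution and
fixes two common points (`exists_common_fixed`): in even order the unique involution is central, so
every element respects its fixed pair; in odd order orbit counting applies
(`exists_common_fixed_of_odd`). Since Γ contains a nontrivial rotation about 0 and ∞, these are the
two points. So Γ consists of scalings and is some `rotGroup N` with n dividing N; condition 2 forces
N = n.

Conversely, a group of scalings has at most one involution, z ↦ -z, whereas each case excluded by
condition 3 supplies two: z ↦ 1/z and z ↦ e^(2πi/m)/z in the dihedral case, and half-turns about two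
coordinate axes for the polyhedra (`fixGroup_ne_rotGroup`). -/

/-- The transformations `z ↦ c z`, `c ≠ 0`, as a group homomorphism. -/
def scale : ℂˣ →* Equiv.Perm (OnePoint ℂ) where
  toFun c := ((Homeomorph.mulLeft₀ (c : ℂ) c.ne_zero).onePointCongr).toEquiv
  map_one' := by
    ext x : 1
    cases x <;> simp [Homeomorph.onePointCongr]
  map_mul' c d := by
    ext x : 1
    cases x <;> simp [Homeomorph.onePointCongr, mul_assoc]

@[simp]
lemma scale_infty (c : ℂˣ) : scale c ∞ = ∞ := rfl

@[simp]
lemma scale_coe (c : ℂˣ) (z : ℂ) : scale c (z : OnePoint ℂ) = ((c * z : ℂ) : OnePoint ℂ) := rfl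

lemma scale_zero (c : ℂˣ) : scale c ((0 : ℂ) : OnePoint ℂ) = ((0 : ℂ) : OnePoint ℂ) := by simp

lemma scale_injective : Function.Injective scale := by
  intro c d h
  have := congrArg (fun f : Equiv.Perm (OnePoint ℂ) => f ((1 : ℂ) : OnePoint ℂ)) h
  simpa [Units.ext_iff] using this

lemma linFrac_of_matrix (a b c d : ℂ) (h : a * d - b * c ≠ 0) :
    ∃ f ∈ linFrac, (f ∞ = if c = 0 then ∞ else ((a / c : ℂ) : OnePoint ℂ)) ∧
      ∀ z : ℂ, f z = if c * z + d = 0 then ∞ else (((a * z + b) / (c * z + d) : ℂ) : OnePoint ℂ) := by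
  let g : GL (Fin 2) ℂ := GeneralLinearGroup.mkOfDetNeZero !![a, b; c, d]
    (by rwa [det_fin_two_of])
  have g00 : g 0 0 = a := rfl
  have g01 : g 0 1 = b := rfl
  have g10 : g 1 0 = c := rfl
  have g11 : g 1 1 = d := rfl
  refine ⟨MulAction.toPermHom _ _ g, ⟨g, rfl⟩, ?_, fun z => ?_⟩
  · rw [MulAction.toPermHom_apply, MulAction.toPerm_apply, smul_infty_eq_ite, g00, g10]
  · rw [MulAction.toPermHom_apply, MulAction.toPerm_apply, smul_some_eq_ite, g00, g10, g01, g11]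

lemma scale_mem_linFrac (c : ℂˣ) : scale c ∈ linFrac := by
  obtain ⟨f, hf, h1, h2⟩ := linFrac_of_matrix c 0 0 1 (by simp)
  convert hf using 1
  ext x : 1
  cases x <;> simp [h1, h2]

/-- The transformation `z ↦ 1 / z`. -/
def inversion : Equiv.Perm (OnePoint ℂ) :=
  MulAction.toPermHom (GL (Fin 2) ℂ) (OnePoint ℂ)
    (GeneralLinearGroup.mkOfDetNeZero !![0, 1; 1, 0] (by simp [det_fin_two_of]))

lemma inversion_mem_linFrac : inversion ∈ linFrac := ⟨_, rfl⟩

@[simp]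
lemma inversion_infty : inversion ∞ = ((0 : ℂ) : OnePoint ℂ) := by
  rw [inversion, MulAction.toPermHom_apply, MulAction.toPerm_apply, smul_infty_eq_ite]
  simp [GeneralLinearGroup.mkOfDetNeZero]

lemma inversion_coe_ite (z : ℂ) :
    inversion (z : OnePoint ℂ) = if z = 0 then ∞ else ((z⁻¹ : ℂ) : OnePoint ℂ) := by
  rw [inversion, MulAction.toPermHom_apply, MulAction.toPerm_apply, smul_some_eq_ite]
  simp [GeneralLinearGroup.mkOfDetNeZero]

@[simp]
lemma inversion_zero : inversion ((0 : ℂ) : OnePoint ℂ) = ∞ := by simp [inversion_coe_ite]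

lemma inversion_coe {z : ℂ} (hz : z ≠ 0) :
    inversion (z : OnePoint ℂ) = ((z⁻¹ : ℂ) : OnePoint ℂ) := by simp [inversion_coe_ite, hz]

@[simp]
lemma inversion_mul_self : inversion * inversion = 1 := by
  ext x : 1
  cases x with
  | infty => simp
  | coe z =>
    by_cases hz : z = 0
    · simp [hz]
    · simp [inversion_coe hz, inversion_coe (inv_ne_zero hz)]

/-- The dihedral relation: z ↦ 1/z conjugates a scaling to its inverse. -/
lemma inversion_mul_scale (c : ℂˣ) : inversion * scale c = scale c⁻¹ * inversion := by
  ext x : 1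
  cases x with
  | infty => simp [-map_inv]
  | coe z =>
    by_cases hz : z = 0
    · simp [hz, -map_inv]
    · simp [inversion_coe hz, inversion_coe (mul_ne_zero c.ne_zero hz), -map_inv, mul_comm z⁻¹]

/-! ### Linear fractional transformations with prescribed fixed points -/

lemma exists_eq_affine {f : Equiv.Perm (OnePoint ℂ)} (hf : f ∈ linFrac) (h : f ∞ = ∞) :
    ∃ (a : ℂˣ) (b : ℂ), ∀ z : ℂ, f z = ((a * z + b : ℂ) : OnePoint ℂ) := by
  obtain ⟨g, rfl⟩ := hf
  rw [MulAction.toPermHom_apply, MulAction.toPerm_apply, smul_infty_eq_self_iff] at h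
  have hdet := g.det_ne_zero
  rw [det_fin_two, h, mul_zero, sub_zero] at hdet
  have h0 : g 0 0 ≠ 0 := left_ne_zero_of_mul hdet
  have h1 : g 1 1 ≠ 0 := right_ne_zero_of_mul hdet
  refine ⟨Units.mk0 (g 0 0 / g 1 1) (div_ne_zero h0 h1), g 0 1 / g 1 1, fun z => ?_⟩
  rw [MulAction.toPermHom_apply, MulAction.toPerm_apply, smul_some_eq_ite]
  simp only [h, zero_mul, zero_add, h1, if_false, Units.val_mk0]
  congr 1
  field_simp

lemma eq_scale_of_fixes {f : Equiv.Perm (OnePoint ℂ)} (hf : f ∈ linFrac) (h : f ∞ = ∞)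
    (h0 : f ((0 : ℂ) : OnePoint ℂ) = ((0 : ℂ) : OnePoint ℂ)) : ∃ c, f = scale c := by
  obtain ⟨a, b, hab⟩ := exists_eq_affine hf h
  have hb : b = 0 := by simpa [hab] using h0
  refine ⟨a, ?_⟩
  ext x : 1
  cases x <;> simp [h, hab, hb]

lemma eq_scale_mul_inversion_of_swaps {f : Equiv.Perm (OnePoint ℂ)} (hf : f ∈ linFrac)
    (h : f ∞ = ((0 : ℂ) : OnePoint ℂ)) (h0 : f ((0 : ℂ) : OnePoint ℂ) = ∞) :
    ∃ c, f = scale c * inversion := by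
  obtain ⟨c, hc⟩ := eq_scale_of_fixes (linFrac.mul_mem hf inversion_mem_linFrac)
    (by simp [h0]) (by simp [h])
  exact ⟨c, by rw [← hc, mul_assoc, inversion_mul_self, mul_one]⟩

lemma exists_translation (b : ℂ) :
    ∃ f ∈ linFrac, f ∞ = ∞ ∧ ∀ z : ℂ, f z = ((z + b : ℂ) : OnePoint ℂ) := by
  obtain ⟨f, hf, h1, h2⟩ := linFrac_of_matrix 1 b 0 1 (by simp)
  exact ⟨f, hf, by simpa using h1, by simpa using h2⟩

lemma exists_apply_eq_infty (p : OnePoint ℂ) : ∃ f ∈ linFrac, f p = ∞ := by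
  cases p with
  | infty => exact ⟨1, one_mem _, rfl⟩
  | coe z =>
    obtain ⟨f, hf, -, h⟩ := exists_translation (-z)
    exact ⟨inversion * f, mul_mem inversion_mem_linFrac hf, by simp [h]⟩

/-- Double transitivity, used to normalise a pair of fixed points to ∞ and 0. -/
lemma exists_apply_eq_infty_zero {p q : OnePoint ℂ} (hpq : p ≠ q) :
    ∃ f ∈ linFrac, f p = ∞ ∧ f q = ((0 : ℂ) : OnePoint ℂ) := by
  obtain ⟨f, hf, hp⟩ := exists_apply_eq_infty p
  obtain ⟨z, hz⟩ : ∃ z : ℂ, f q = z := by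
    cases hq : f q with
    | infty => exact absurd (f.injective (hp.trans hq.symm)) hpq
    | coe z => exact ⟨z, rfl⟩
  obtain ⟨g, hg, h1, h2⟩ := exists_translation (-z)
  exact ⟨g * f, mul_mem hg hf, by simp [hp, h1], by simp [hz, h2]⟩

lemma exists_fixed_point {f : Equiv.Perm (OnePoint ℂ)} (hf : f ∈ linFrac) : ∃ p, f p = p := by
  obtain ⟨g, rfl⟩ := hf
  simp only [MulAction.toPermHom_apply, MulAction.toPerm_apply]
  by_cases h : g 1 0 = 0
  · exact ⟨∞, smul_infty_eq_self_iff.2 h⟩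
  -- For z ↦ (az + b)/(cz + d), the fixed points solve cz² + (d - a)z - b = 0; s is a square root of
  -- its discriminant.
  · obtain ⟨s, hs⟩ := IsAlgClosed.exists_pow_nat_eq
      ((g 1 1 - g 0 0) ^ 2 + 4 * g 1 0 * g 0 1) (n := 2) (by norm_num)
    refine ⟨(((s - (g 1 1 - g 0 0)) / (2 * g 1 0) : ℂ) : OnePoint ℂ), ?_⟩
    rw [← GeneralLinearGroup.fixpointPolynomial_aeval_eq_zero_iff]
    simp only [GeneralLinearGroup.fixpointPolynomial, map_sub, map_mul, map_add,
      Polynomial.aeval_X_pow, Polynomial.aeval_C, Polynomial.aeval_X,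
      Algebra.algebraMap_self_apply]
    field_simp
    linear_combination hs

/-- A linear fractional transformation with three fixed points is the identity. -/
lemma eq_one_of_three_fixed {f : Equiv.Perm (OnePoint ℂ)} (hf : f ∈ linFrac) {p q r : OnePoint ℂ}
    (hpq : p ≠ q) (hpr : p ≠ r) (hqr : q ≠ r) (hp : f p = p) (hq : f q = q) (hr : f r = r) :
    f = 1 := by
  obtain ⟨ψ, hψ, h1, h2⟩ := exists_apply_eq_infty_zero hpq
  have e : ∀ x, (ψ * f * ψ⁻¹) (ψ x) = ψ (f x) := by simp
  obtain ⟨c, hc⟩ := eq_scale_of_fixes (f := ψ * f * ψ⁻¹) (mul_mem (mul_mem hψ hf) (inv_mem hψ))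
    (by rw [← h1, e, hp]) (by rw [← h2, e, hq])
  have hr' : scale c (ψ r) = ψ r := by rw [← hc, e, hr]
  have hc1 : c = 1 := by
    cases h : ψ r with
    | infty => exact absurd (ψ.injective (h1.trans h.symm)) hpr
    | coe z =>
      have hz : z ≠ 0 := by
        rintro rfl
        exact hqr (ψ.injective (h2.trans h.symm))
      rw [h, scale_coe, OnePoint.coe_eq_coe] at hr'
      exact Units.ext (mul_right_cancel₀ hz (by simpa using hr'))
  rw [hc1, map_one] at hc
  exact conj_eq_one_iff.1 hc

/-- A linear fractional transformation of finite order is conjugate to some `z ↦ c z`. -/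
lemma exists_conj_eq_scale {f : Equiv.Perm (OnePoint ℂ)} (hf : f ∈ linFrac)
    (hfin : IsOfFinOrder f) : ∃ ψ ∈ linFrac, ∃ c, ψ * f * ψ⁻¹ = scale c := by
  by_cases hf1 : f = 1
  · exact ⟨1, one_mem _, 1, by simp [hf1]⟩
  obtain ⟨p, hp⟩ := exists_fixed_point hf
  obtain ⟨φ, hφ, h1⟩ := exists_apply_eq_infty p
  have hg : φ * f * φ⁻¹ ∈ linFrac := mul_mem (mul_mem hφ hf) (inv_mem hφ)
  have hg1 : (φ * f * φ⁻¹) ∞ = ∞ := by simp [← h1, hp]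
  obtain ⟨m, hm, hfm⟩ := isOfFinOrder_iff_pow_eq_one.1 hfin
  have hgm : (φ * f * φ⁻¹) ^ m = 1 := by rw [conj_pow, hfm]; simp
  obtain ⟨a, b, hab⟩ := exists_eq_affine hg hg1
  -- With a = 1 the map is a translation, and finite order makes it trivial.
  by_cases ha : (a : ℂ) = 1
  · exfalso
    have key : ∀ (k : ℕ) (z : ℂ), ((φ * f * φ⁻¹) ^ k) (z : OnePoint ℂ) =
        ((z + k * b : ℂ) : OnePoint ℂ) := by
      intro k
      induction k with
      | zero => simp
      | succ k ih =>
        intro z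
        rw [pow_succ', Equiv.Perm.mul_apply, ih, hab, ha]
        push_cast
        congr 1
        ring
    have hb : b = 0 := by
      have := key m 0
      rw [hgm, Equiv.Perm.one_apply, OnePoint.coe_eq_coe] at this
      simpa [hm.ne'] using this.symm
    apply hf1
    have : φ * f * φ⁻¹ = 1 := by
      ext x : 1
      cases x with
      | infty => simpa using hg1
      | coe z => rw [hab, ha, hb]; simp
    exact conj_eq_one_iff.1 this
  -- The second fixed point of z ↦ az + b is b/(1 - a); translate it to 0.
  · have ha' : 1 - (a : ℂ) ≠ 0 := fun h => ha (sub_eq_zero.1 h).symm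
    obtain ⟨τ, hτ, h2, h3⟩ := exists_translation (-(b / (1 - a)))
    have e : ∀ x, ((τ * φ) * f * (τ * φ)⁻¹) (τ x) = τ ((φ * f * φ⁻¹) x) := by simp [mul_assoc]
    have h4 : τ ((b / (1 - a) : ℂ) : OnePoint ℂ) = ((0 : ℂ) : OnePoint ℂ) := by simp [h3]
    obtain ⟨c, hc⟩ := eq_scale_of_fixes (f := (τ * φ) * f * (τ * φ)⁻¹)
      (mul_mem (mul_mem (mul_mem hτ hφ) hf) (inv_mem (mul_mem hτ hφ)))
      (by rw [← h2, e, hg1]) (by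
        rw [← h4, e, hab]
        congr 2
        field_simp
        ring)
    exact ⟨τ * φ, mul_mem hτ hφ, c, hc⟩

lemma scale_eq_self_iff {c : ℂˣ} (hc : c ≠ 1) (x : OnePoint ℂ) :
    scale c x = x ↔ x = ∞ ∨ x = ((0 : ℂ) : OnePoint ℂ) := by
  cases x with
  | infty => simp
  | coe z =>
    have : (c : ℂ) ≠ 1 := by simpa using hc
    simp only [scale_coe, OnePoint.coe_eq_coe, OnePoint.coe_ne_infty, false_or, mul_left_eq_self₀, this]

/-- A nontrivial linear fractional transformation of finite order has two fixed points. -/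
lemma ncard_fixedPoints {f : Equiv.Perm (OnePoint ℂ)} (hf : f ∈ linFrac)
    (hfin : IsOfFinOrder f) (hf1 : f ≠ 1) : {x | f x = x}.ncard = 2 := by
  obtain ⟨ψ, hψ, c, hc⟩ := exists_conj_eq_scale hf hfin
  have hc1 : c ≠ 1 := by
    rintro rfl
    rw [map_one] at hc
    exact hf1 (conj_eq_one_iff.1 hc)
  have hx : ∀ x, f x = x ↔ ψ x = ∞ ∨ ψ x = ((0 : ℂ) : OnePoint ℂ) := fun x => by
    rw [← scale_eq_self_iff hc1, ← hc]; simp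
  rw [Set.ncard_eq_two]
  refine ⟨ψ⁻¹ ∞, ψ⁻¹ ((0 : ℂ) : OnePoint ℂ), by simp, ?_⟩
  ext x
  simp [hx, Equiv.eq_symm_apply, Equiv.Perm.inv_def]

/-! ### Finite groups of linear fractional transformations -/

/-- If a nontrivial finite group of odd order acts so that each nontrivial element has exactly two
fixed points, then these two points are common to all elements. -/
theorem exists_common_fixed_of_odd {G Y : Type*} [Group G] [MulAction G Y] [Finite G]
    [Nontrivial G] (hodd : Odd (Nat.card G))
    (hfix : ∀ g : G, g ≠ 1 → {y : Y | g • y = y}.ncard = 2) :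
    ∃ p q : Y, p ≠ q ∧ ∀ g : G, g • p = p ∧ g • q = q := by
  classical
  -- Burnside's lemma is applied to the set of points with nontrivial stabilizer.
  let X : SubMulAction G Y :=
    { carrier := {y | ∃ g : G, g ≠ 1 ∧ g • y = y}
      smul_mem' := by
        rintro h y ⟨g, hg, hy⟩
        exact ⟨h * g * h⁻¹, fun e => hg (conj_eq_one_iff.1 e), by simp [mul_smul, hy]⟩ }
  have hXmem : ∀ y : Y, y ∈ X ↔ ∃ g : G, g ≠ 1 ∧ g • y = y := fun y => Iff.rfl
  have hXfin : (X : Set Y).Finite := by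
    have : (X : Set Y) = ⋃ g ∈ {g : G | g ≠ 1}, {y : Y | g • y = y} := by
      ext y
      simp [hXmem]
    rw [this]
    exact (Set.toFinite _).biUnion fun g hg =>
      Set.finite_of_ncard_ne_zero (by rw [hfix g hg]; norm_num)
  have hsub : ∀ g : G, g ≠ 1 → {y : Y | g • y = y} ⊆ X := fun g hg y hy => ⟨g, hg, hy⟩
  have : Finite X := hXfin
  have := Fintype.ofFinite X
  have := Fintype.ofFinite G
  have hfixX : ∀ g : G, g ≠ 1 → Fintype.card (MulAction.fixedBy X g) = 2 := by
    intro g hg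
    rw [← Nat.card_eq_fintype_card, Nat.card_coe_set_eq,
      ← Set.ncard_image_of_injective _ Subtype.val_injective, ← hfix g hg]
    congr 1
    ext y
    constructor
    · rintro ⟨x, hx, rfl⟩
      exact congrArg Subtype.val hx
    · intro hy
      exact ⟨⟨y, hsub g hg hy⟩, Subtype.ext hy, rfl⟩
  have hN : 3 ≤ Nat.card G := by
    have := Finite.one_lt_card (α := G)
    obtain ⟨k, hk⟩ := hodd
    omega
  have hsum : ∑ g : G, Fintype.card (MulAction.fixedBy X g) =
      Nat.card X + 2 * (Nat.card G - 1) := by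
    rw [← Finset.add_sum_erase _ _ (Finset.mem_univ (1 : G)),
      Finset.sum_congr rfl fun g hg => hfixX g (Finset.ne_of_mem_erase hg), Finset.sum_const,
      Finset.card_erase_of_mem (Finset.mem_univ _), Finset.card_univ, ← Nat.card_eq_fintype_card,
      ← Nat.card_eq_fintype_card, smul_eq_mul, mul_comm]
    congr 1
    rw [Nat.card_coe_set_eq, MulAction.fixedBy_one_eq_univ, Set.ncard_univ]
  -- Oddness enters here: a nontrivial group of odd order has at least three elements.
  have hstab : ∀ x : X, 3 ≤ Fintype.card (MulAction.stabilizer G x) := by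
    intro x
    obtain ⟨g, hg, hx⟩ := x.2
    have : Nontrivial (MulAction.stabilizer G x) :=
      ⟨⟨g, Subtype.ext hx⟩, 1, fun e => hg (congrArg Subtype.val e)⟩
    have h1 := Finite.one_lt_card (α := MulAction.stabilizer G x)
    obtain ⟨k, hk⟩ := hodd.of_dvd_nat (Subgroup.card_subgroup_dvd_card (MulAction.stabilizer G x))
    rw [← Nat.card_eq_fintype_card]
    omega
  have hcount : ∑ g : G, Fintype.card (MulAction.fixedBy X g) =
      ∑ x : X, Fintype.card (MulAction.stabilizer G x) := by
    rw [← Fintype.card_sigma, ← Fintype.card_sigma]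
    exact Fintype.card_congr
      ⟨fun a => ⟨a.2.1, a.1, a.2.2⟩, fun a => ⟨a.2.1, a.1, a.2.2⟩, fun _ => rfl, fun _ => rfl⟩
  have h3 : 3 * Nat.card X ≤ ∑ x : X, Fintype.card (MulAction.stabilizer G x) := by
    rw [Nat.card_eq_fintype_card, mul_comm, ← smul_eq_mul, ← Finset.card_univ, ← Finset.sum_const]
    exact Finset.sum_le_sum fun x _ => hstab x
  have hburn := MulAction.sum_card_fixedBy_eq_card_orbits_mul_card_group G X
  rw [hsum, ← Nat.card_eq_fintype_card (α := G)] at hburn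
  obtain ⟨g₀, hg₀⟩ := exists_ne (1 : G)
  have hX2 : 2 ≤ Nat.card X := by
    rw [← hfix g₀ hg₀]
    exact Set.ncard_le_ncard (hsub g₀ hg₀) hXfin
  rw [← hcount, hsum] at h3
  -- With N = |G| and k the number of orbits, kN = |X| + 2(N - 1). The stabilizer bound gives |X| ≤
  -- N - 1, hence k < 3, and |X| ≥ 2 gives k ≥ 2. Then k = 2 forces |X| = 2.
  have hk : Fintype.card (Quotient (MulAction.orbitRel G X)) = 2 := by
    apply le_antisymm
    · by_contra! h
      have := Nat.mul_le_mul_right (Nat.card G) h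
      omega
    · by_contra! h
      have := Nat.mul_le_mul_right (Nat.card G) (Nat.le_of_lt_succ h)
      omega
  rw [hk] at hburn
  have hX : (X : Set Y).ncard = 2 := by
    have : (X : Set Y).ncard = Nat.card X := rfl
    omega
  obtain ⟨p, q, hpq, hXe⟩ := Set.ncard_eq_two.1 hX
  have hall : ∀ g : G, ∀ y ∈ (X : Set Y), g • y = y := by
    intro g y hy
    by_cases hg : g = 1
    · simp [hg]
    · rw [← Set.eq_of_subset_of_ncard_le (hsub g hg) (by rw [hX, hfix g hg]) hXfin] at hy
      exact hy
  exact ⟨p, q, hpq, fun g => ⟨hall g p (by simp [hXe]), hall g q (by simp [hXe])⟩⟩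

/-! ### Involutions and maps intertwining scalings -/

/-- The two solutions of `c² = 1`. -/
lemma units_eq_neg_one {c : ℂˣ} (h : c * c = 1) (h1 : c ≠ 1) : c = -1 := by
  have h' : (c : ℂ) * c = 1 := by simpa using congrArg Units.val h
  rcases mul_self_eq_one_iff.1 h' with h2 | h2
  · exact absurd (Units.ext h2) h1
  · exact Units.ext h2

lemma eq_infty_or_zero_of_comm {f : Equiv.Perm (OnePoint ℂ)} {c d : ℂˣ} (hc : c ≠ 1)
    (h : f * scale d = scale c * f) {x : OnePoint ℂ} (hx : x = ∞ ∨ x = ((0 : ℂ) : OnePoint ℂ)) :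
    f x = ∞ ∨ f x = ((0 : ℂ) : OnePoint ℂ) := by
  rw [← scale_eq_self_iff hc, ← Equiv.Perm.mul_apply, ← h, Equiv.Perm.mul_apply]
  rcases hx with rfl | rfl
  · rw [scale_infty]
  · rw [scale_zero]

/-- A linear fractional transformation that intertwines two nontrivial scalings preserves
`{0, ∞}`. -/
lemma eq_scale_or_eq_scale_mul_inversion {f : Equiv.Perm (OnePoint ℂ)} (hf : f ∈ linFrac)
    {c d : ℂˣ} (hc : c ≠ 1) (h : f * scale d = scale c * f) :
    (∃ e, f = scale e) ∨ ∃ e, f = scale e * inversion := by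
  have hne : f ∞ ≠ f ((0 : ℂ) : OnePoint ℂ) := fun e => by simpa using f.injective e
  rcases eq_infty_or_zero_of_comm hc h (Or.inl rfl) with h1 | h1 <;>
    rcases eq_infty_or_zero_of_comm hc h (Or.inr rfl) with h2 | h2
  · exact absurd (h1.trans h2.symm) hne
  · exact Or.inl (eq_scale_of_fixes hf h1 h2)
  · exact Or.inr (eq_scale_mul_inversion_of_swaps hf h1 h2)
  · exact absurd (h1.trans h2.symm) hne

lemma scale_mul_inversion_sq (e : ℂˣ) : scale e * inversion * (scale e * inversion) = 1 := by
  rw [mul_assoc, ← mul_assoc inversion, inversion_mul_scale, mul_assoc (scale e⁻¹),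
    inversion_mul_self, mul_one, ← map_mul, mul_inv_cancel, map_one]

/-- A nontrivial finite group of linear fractional transformations with at most one involution has
two fixed points. -/
theorem exists_common_fixed {Γ : Subgroup (Equiv.Perm (OnePoint ℂ))} [Finite Γ]
    (hΓ : Γ ≤ linFrac) (hne : Γ ≠ ⊥)
    (hinv : ∀ s ∈ Γ, ∀ t ∈ Γ, s ≠ 1 → t ≠ 1 → s * s = 1 → t * t = 1 → s = t) :
    ∃ p q : OnePoint ℂ, p ≠ q ∧ ∀ f ∈ Γ, f p = p ∧ f q = q := by
  have hord : ∀ f ∈ Γ, IsOfFinOrder f := fun f hf =>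
    Submonoid.isOfFinOrder_coe.2 (isOfFinOrder_of_finite (⟨f, hf⟩ : Γ))
  rcases Nat.even_or_odd (Nat.card Γ) with hev | hodd
  · have : Fact (Nat.Prime 2) := ⟨Nat.prime_two⟩
    obtain ⟨⟨s, hs⟩, hs2⟩ := exists_prime_orderOf_dvd_card' (G := Γ) 2 hev.two_dvd
    rw [orderOf_eq_prime_iff] at hs2
    have hss : s * s = 1 := by simpa [sq] using congrArg Subtype.val hs2.1
    have hs1 : s ≠ 1 := fun e => hs2.2 (Subtype.ext e)
    obtain ⟨ψ, hψ, c, hc⟩ := exists_conj_eq_scale (hΓ hs) (hord s hs)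
    have hc1 : c ≠ 1 := by
      rintro rfl
      rw [map_one] at hc
      exact hs1 (conj_eq_one_iff.1 hc)
    refine ⟨ψ⁻¹ ∞, ψ⁻¹ ((0 : ℂ) : OnePoint ℂ), by simp, fun f hf => ?_⟩
    -- Every conjugate of s is an involution of the group, hence s itself.
    have hcomm : f * s * f⁻¹ = s := by
      refine hinv _ (mul_mem (mul_mem hf hs) (inv_mem hf)) s hs
        (fun e => hs1 (conj_eq_one_iff.1 e)) hs1 ?_ hss
      rw [← sq, conj_pow, sq, hss]
      simp
    have hcomm' : (ψ * f * ψ⁻¹) * scale c = scale c * (ψ * f * ψ⁻¹) := by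
      rw [← hc]
      have : f * s = s * f := by rw [← mul_inv_eq_iff_eq_mul, hcomm]
      simp only [mul_assoc, inv_mul_cancel_left]
      rw [← mul_assoc f, this, mul_assoc]
    have hlin := mul_mem (mul_mem hψ (hΓ hf)) (inv_mem hψ)
    obtain ⟨e, he⟩ : ∃ e, ψ * f * ψ⁻¹ = scale e := by
      rcases eq_scale_or_eq_scale_mul_inversion hlin hc1 hcomm' with he | ⟨e, he⟩
      · exact he
      -- An element swapping the two points would be an involution, hence s, which is a scaling
      -- after conjugation.
      · have h1 : f * f = 1 := by
          have := scale_mul_inversion_sq e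
          rwa [← he, ← sq, conj_pow, conj_eq_one_iff, sq] at this
        by_cases h2 : f = 1
        · exact ⟨1, by simp [h2]⟩
        · exact ⟨c, by rw [hinv f hf s hs h2 hs1 h1 hss, hc]⟩
    have : f = ψ⁻¹ * scale e * ψ := by rw [← he]; group
    rw [this]
    simp
  · have : Nontrivial Γ := (Subgroup.nontrivial_iff_ne_bot Γ).2 hne
    obtain ⟨p, q, hpq, h⟩ := exists_common_fixed_of_odd (G := Γ) (Y := OnePoint ℂ) hodd
      fun g hg => ncard_fixedPoints (hΓ g.2) (hord g g.2) fun e => hg (Subtype.ext e)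
    exact ⟨p, q, hpq, fun f hf => h ⟨f, hf⟩⟩

/-- Two distinct involutions of a finite group of linear fractional transformations generate,
up to conjugation, a group containing `z ↦ 1 / z` and some nontrivial `z ↦ c z`. -/
theorem exists_conj_dihedral {Γ : Subgroup (Equiv.Perm (OnePoint ℂ))} [Finite Γ]
    (hΓ : Γ ≤ linFrac) {s t : Equiv.Perm (OnePoint ℂ)} (hs : s ∈ Γ) (ht : t ∈ Γ) (hs1 : s ≠ 1)
    (ht1 : t ≠ 1) (hss : s * s = 1) (htt : t * t = 1) (hst : s ≠ t) :
    ∃ ψ ∈ linFrac, ∃ c : ℂˣ, c ≠ 1 ∧ ψ⁻¹ * scale c * ψ ∈ Γ ∧ ψ⁻¹ * inversion * ψ ∈ Γ := by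
  have hstΓ := mul_mem hs ht
  obtain ⟨ψ, hψ, c, hc⟩ := exists_conj_eq_scale (hΓ hstΓ)
    (Submonoid.isOfFinOrder_coe.2 (isOfFinOrder_of_finite (⟨s * t, hstΓ⟩ : Γ)))
  have hsi : s⁻¹ = s := inv_eq_of_mul_eq_one_left hss
  have hti : t⁻¹ = t := inv_eq_of_mul_eq_one_left htt
  have hc1 : c ≠ 1 := by
    rintro rfl
    rw [map_one, conj_eq_one_iff, mul_eq_one_iff_eq_inv, hti] at hc
    exact hst hc
  -- This is s(st) = (st)⁻¹s, conjugated by `ψ`.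
  have hcomm : (ψ * s * ψ⁻¹) * scale c = scale c⁻¹ * (ψ * s * ψ⁻¹) := by
    rw [map_inv, ← hc]
    simp only [_root_.mul_inv_rev, hsi, hti, inv_inv, mul_assoc, inv_mul_cancel_left]
    rw [← mul_assoc s s, hss, one_mul, ← mul_assoc s s, hss, one_mul]
  have hlin := mul_mem (mul_mem hψ (hΓ hs)) (inv_mem hψ)
  rcases eq_scale_or_eq_scale_mul_inversion hlin (inv_ne_one.2 hc1) hcomm with ⟨e, he⟩ | ⟨e, he⟩
  -- If s became a scaling, so would t; both would be z ↦ -z and c would be 1.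
  · exfalso
    have he1 : e = -1 := by
      refine units_eq_neg_one (scale_injective ?_) ?_
      · rw [map_mul, ← he, ← sq, conj_pow, sq, hss, map_one]; simp
      · rintro rfl
        rw [map_one, conj_eq_one_iff] at he
        exact hs1 he
    have htc : ψ * t * ψ⁻¹ = scale (e * c) := by
      rw [map_mul, ← he, ← hc]
      simp only [mul_assoc, inv_mul_cancel_left]
      rw [← mul_assoc s s, hss, one_mul]
    have hec : e * c = -1 := by
      refine units_eq_neg_one (scale_injective ?_) ?_
      · rw [map_mul, ← htc, ← sq, conj_pow, sq, htt, map_one]; simp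
      · intro h
        rw [h, map_one, conj_eq_one_iff] at htc
        exact ht1 htc
    rw [he1] at hec
    exact hc1 (by simpa using hec)
  -- Conjugating z ↦ e/z by the inverse of a square root of e gives z ↦ 1/z, and leaves the scaling
  -- by c unchanged.
  · obtain ⟨r, hr⟩ := IsAlgClosed.exists_pow_nat_eq (e : ℂ) (n := 2) (by norm_num)
    have hr0 : r ≠ 0 := by
      rintro rfl
      exact e.ne_zero (by simpa using hr.symm)
    obtain ⟨u, hu⟩ : ∃ u : ℂˣ, u * u = e := ⟨Units.mk0 r hr0, Units.ext (by simpa [sq] using hr)⟩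
    refine ⟨scale u⁻¹ * ψ, mul_mem (scale_mem_linFrac _) hψ, c, hc1, ?_, ?_⟩
    · convert hstΓ using 1
      have : s * t = ψ⁻¹ * scale c * ψ := by rw [← hc]; group
      rw [this, _root_.mul_inv_rev, ← map_inv, inv_inv]
      have h2 : scale u * (scale c * scale u⁻¹) = scale c := by
        rw [← map_mul, ← map_mul, mul_comm c, mul_inv_cancel_left]
      conv_rhs => rw [← h2]
      simp only [mul_assoc]
    · convert hs using 1
      have : s = ψ⁻¹ * (scale e * inversion) * ψ := by rw [← he]; group
      rw [this, _root_.mul_inv_rev, ← map_inv, inv_inv, ← hu]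
      have h2 : scale (u * u) * inversion = scale u * (inversion * scale u⁻¹) := by
        rw [inversion_mul_scale, inv_inv, map_mul, mul_assoc]
      rw [h2]
      simp only [mul_assoc]

/-! ### The stabilizer of a finite set -/

lemma fixGroup_le_linFrac (α : Set (OnePoint ℂ)) : fixGroup α ≤ linFrac := inf_le_left

lemma mem_fixGroup {α : Set (OnePoint ℂ)} {f : Equiv.Perm (OnePoint ℂ)} :
    f ∈ fixGroup α ↔ f ∈ linFrac ∧ f '' α = α := Iff.rfl

/-- Restriction to `α` is injective, since two elements agreeing on three points of `α` are equal.
-/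
lemma finite_fixGroup {α : Set (OnePoint ℂ)} (hfin : α.Finite) (h3 : 3 ≤ α.ncard) :
    Finite (fixGroup α) := by
  have : Finite α := hfin
  refine Finite.of_injective
    (fun (f : fixGroup α) (a : α) => (⟨f.1 a, by
      have := Set.mem_image_of_mem f.1 a.2
      rwa [(mem_fixGroup.1 f.2).2] at this⟩ : α)) ?_
  intro f g hfg
  obtain ⟨x, hx, y, hy, z, hz, hxy, hxz, hyz⟩ := (Set.two_lt_ncard hfin).1 h3
  have key : ∀ a ∈ α, (g.1⁻¹ * f.1) a = a := by
    intro a ha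
    have := congrArg Subtype.val (congrFun hfg ⟨a, ha⟩)
    simp only at this
    simp [this]
  have := eq_one_of_three_fixed
    (mul_mem (inv_mem (fixGroup_le_linFrac α g.2)) (fixGroup_le_linFrac α f.2))
    hxy hxz hyz (key x hx) (key y hy) (key z hz)
  exact Subtype.ext (inv_mul_eq_one.1 this).symm

/-- Conjugation by `ψ` carries `fixGroup α` to `fixGroup (ψ '' α)`. -/
lemma conj_mem_fixGroup_iff {α : Set (OnePoint ℂ)} {ψ f : Equiv.Perm (OnePoint ℂ)}
    (hψ : ψ ∈ linFrac) : ψ⁻¹ * f * ψ ∈ fixGroup α ↔ f ∈ fixGroup (ψ '' α) := by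
  have h1 : ψ⁻¹ * f * ψ ∈ linFrac ↔ f ∈ linFrac := by
    rw [Subgroup.mul_mem_cancel_right _ hψ, Subgroup.mul_mem_cancel_left _ (inv_mem hψ)]
  have h2 : (ψ⁻¹ * f * ψ) '' α = α ↔ f '' (ψ '' α) = ψ '' α := by
    change (ψ⁻¹ * f * ψ) • α = α ↔ f • ψ • α = ψ • α
    rw [mul_smul, mul_smul, inv_smul_eq_iff]
  rw [mem_fixGroup, mem_fixGroup, h1, h2]

/-! ### The cyclic groups -/

lemma expTurn_add (x y : ℝ) : expTurn (x + y) = expTurn x * expTurn y := by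
  rw [expTurn, expTurn, expTurn, ← Complex.exp_add]
  push_cast
  rw [add_mul]

lemma expTurn_ne_zero (x : ℝ) : expTurn x ≠ 0 := Complex.exp_ne_zero _

lemma isPrimitiveRoot_expTurn {n : ℕ} (hn : n ≠ 0) : IsPrimitiveRoot (expTurn (1 / n)) n := by
  convert Complex.isPrimitiveRoot_exp n hn using 1
  rw [expTurn]
  congr 1
  push_cast
  ring

/-- The nonzero number `e ^ (2 π i x)`. -/
def expTurnUnit (x : ℝ) : ℂˣ := Units.mk0 (expTurn x) (expTurn_ne_zero x)

@[simp]
lemma val_expTurnUnit (x : ℝ) : (expTurnUnit x : ℂ) = expTurn x := rfl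

lemma expTurn_zero : expTurn 0 = 1 := by simp [expTurn]

lemma expTurnUnit_add (x y : ℝ) : expTurnUnit (x + y) = expTurnUnit x * expTurnUnit y :=
  Units.ext (expTurn_add x y)

lemma expTurnUnit_zero : expTurnUnit 0 = 1 := Units.ext expTurn_zero

lemma expTurnUnit_neg (x : ℝ) : expTurnUnit (-x) = (expTurnUnit x)⁻¹ := by
  rw [eq_inv_iff_mul_eq_one, ← expTurnUnit_add, neg_add_cancel, expTurnUnit_zero]

lemma expTurn_neg (x : ℝ) : expTurn (-x) = (expTurn x)⁻¹ := by
  simpa using congrArg Units.val (expTurnUnit_neg x)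

lemma expTurnUnit_zpow (x : ℝ) (k : ℤ) : expTurnUnit x ^ k = expTurnUnit (k * x) := by
  induction k using Int.induction_on with
  | zero => simp [expTurnUnit_zero]
  | succ k ih =>
    rw [_root_.zpow_add_one, ih, ← expTurnUnit_add]
    push_cast
    rw [add_mul, one_mul]
  | pred k ih =>
    rw [_root_.zpow_sub_one, ih, ← expTurnUnit_neg, ← expTurnUnit_add]
    push_cast
    rw [sub_mul, one_mul, sub_eq_add_neg]

lemma isPrimitiveRoot_expTurnUnit {n : ℕ} (hn : n ≠ 0) :
    IsPrimitiveRoot (expTurnUnit (1 / n)) n :=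
  IsPrimitiveRoot.coe_units_iff.1 (isPrimitiveRoot_expTurn hn)

lemma rot_eq_scale (n : ℕ) : rot n = scale (expTurnUnit (1 / n)) := rfl

lemma orderOf_rot {n : ℕ} (hn : n ≠ 0) : orderOf (rot n) = n := by
  rw [rot_eq_scale, orderOf_injective scale scale_injective,
    ← (isPrimitiveRoot_expTurnUnit hn).eq_orderOf]

lemma rotGroup_eq_zpowers (n : ℕ) : rotGroup n = Subgroup.zpowers (rot n) :=
  (Subgroup.zpowers_eq_closure _).symm

lemma rot_mem_rotGroup (n : ℕ) : rot n ∈ rotGroup n := by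
  rw [rotGroup_eq_zpowers]
  exact Subgroup.mem_zpowers _

lemma card_rotGroup {n : ℕ} (hn : n ≠ 0) : Nat.card (rotGroup n) = n := by
  rw [rotGroup_eq_zpowers, Nat.card_zpowers, orderOf_rot hn]

lemma rot_zpow (n : ℕ) (k : ℤ) : rot n ^ k = scale (expTurnUnit (k / n)) := by
  rw [rot_eq_scale, ← map_zpow, expTurnUnit_zpow, mul_one_div]

lemma exists_eq_scale_of_mem_rotGroup {n : ℕ} {f : Equiv.Perm (OnePoint ℂ)}
    (hf : f ∈ rotGroup n) : ∃ c, f = scale c := by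
  rw [rotGroup_eq_zpowers] at hf
  obtain ⟨k, rfl⟩ := hf
  exact ⟨_, rot_zpow n k⟩

lemma nonempty_rotGroup_mulEquiv {n : ℕ} (hn : n ≠ 0) :
    Nonempty (rotGroup n ≃* Multiplicative (ZMod n)) := by
  have : IsCyclic (rotGroup n) := by
    rw [rotGroup_eq_zpowers]
    infer_instance
  have e := zmodCyclicMulEquiv this
  rw [card_rotGroup hn] at e
  exact ⟨e.symm⟩

/-- A power of `c` equals `e ^ (2 π i / m)` where `m` is the order of `c`. -/
lemma exists_pow_eq_expTurnUnit {c : ℂˣ} (hc : IsOfFinOrder c) :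
    ∃ k : ℕ, c ^ k = expTurnUnit (1 / (orderOf c : ℕ)) := by
  have : NeZero (orderOf c) := ⟨hc.orderOf_pos.ne'⟩
  obtain ⟨k, -, hk⟩ := (IsPrimitiveRoot.coe_units_iff.2 (IsPrimitiveRoot.orderOf c)
    ).eq_pow_of_pow_eq_one (isPrimitiveRoot_expTurn hc.orderOf_pos.ne').pow_eq_one
  exact ⟨k, Units.ext (by simpa using hk)⟩

/-- A finite group of transformations `z ↦ c z` is one of the standard cyclic groups. -/
lemma eq_rotGroup_of_forall_scale {Γ : Subgroup (Equiv.Perm (OnePoint ℂ))} [Finite Γ]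
    (h : ∀ f ∈ Γ, ∃ c, f = scale c) : Γ = rotGroup (Nat.card Γ) := by
  have hN : Nat.card Γ ≠ 0 := Nat.card_pos.ne'
  have : NeZero (Nat.card Γ) := ⟨hN⟩
  have : Finite (rotGroup (Nat.card Γ)) :=
    Nat.finite_of_card_ne_zero (by rwa [card_rotGroup hN])
  refine Subgroup.eq_of_le_of_card_ge ?_ (card_rotGroup hN).le
  intro f hf
  obtain ⟨c, rfl⟩ := h f hf
  have h1 : (⟨scale c, hf⟩ : Γ) ^ Nat.card Γ = 1 := pow_card_eq_one'
  have h2 : c ^ Nat.card Γ = 1 := scale_injective (by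
    rw [map_pow, map_one]
    exact congrArg Subtype.val h1)
  obtain ⟨k, -, hk⟩ := (isPrimitiveRoot_expTurn hN).eq_pow_of_pow_eq_one (ξ := (c : ℂ))
    (by simpa using congrArg Units.val h2)
  have h3 : c = expTurnUnit (1 / (Nat.card Γ : ℕ)) ^ k := Units.ext (by simpa using hk.symm)
  rw [h3, map_pow, ← rot_eq_scale]
  exact pow_mem (rot_mem_rotGroup _) _

/-! ### Orbits of the cyclic groups -/

theorem cyclicOrbit_mul {n p : ℕ} (hn : n ≠ 0) (hp : p ≠ 0) (z : ℂ) :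
    cyclicOrbit (p * n) z =
      ⋃ j ∈ Finset.range p, cyclicOrbit n (expTurn ((j : ℝ) / ((p : ℝ) * (n : ℝ))) * z) := by
  have hn' : (n : ℝ) ≠ 0 := Nat.cast_ne_zero.2 hn
  have hp' : (p : ℝ) ≠ 0 := Nat.cast_ne_zero.2 hp
  ext w
  simp only [Set.mem_iUnion, Finset.mem_range, exists_prop]
  constructor
  · rintro ⟨k, rfl⟩
    have hpz : (p : ℤ) ≠ 0 := by exact_mod_cast hp
    -- The remainder of k modulo p selects the suborbit, the quotient the position in it.
    obtain ⟨j, hj⟩ := Int.eq_ofNat_of_zero_le (Int.emod_nonneg k hpz)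
    have hlt := Int.emod_lt_of_pos k (by positivity : (0 : ℤ) < p)
    refine ⟨j, by omega, k / p, ?_⟩
    rw [← mul_assoc, ← expTurn_add]
    have hk : (k : ℝ) = p * (k / p : ℤ) + j := by
      have := Int.mul_ediv_add_emod k p
      rw [hj] at this
      exact_mod_cast this.symm
    congr 3
    rw [hk]
    push_cast
    field_simp
  · rintro ⟨j, -, k, rfl⟩
    refine ⟨p * k + j, ?_⟩
    rw [← mul_assoc, ← expTurn_add]
    congr 3
    push_cast
    field_simp

/-! ### Unions of cells as invariance under a group -/

lemma mapsTo_of_isUnionOf {X : Type} {cells : Set (Set X)} {S : Set X} {f : X → X}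
    (h : IsUnionOf cells S) (hf : ∀ T ∈ cells, Set.MapsTo f T T) : Set.MapsTo f S S := by
  obtain ⟨𝒯, h𝒯, rfl⟩ := h
  rintro x ⟨T, hT, hx⟩
  exact ⟨T, hT, hf T (h𝒯 hT) hx⟩

lemma isUnionOf_of_forall {X : Type} {cells : Set (Set X)} {S : Set X}
    (h : ∀ x ∈ S, ∃ T ∈ cells, x ∈ T ∧ T ⊆ S) : IsUnionOf cells S := by
  refine ⟨{T | T ∈ cells ∧ T ⊆ S}, fun T hT => hT.1, ?_⟩
  ext x
  constructor
  · intro hx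
    obtain ⟨T, hT, hxT, hTS⟩ := h x hx
    exact ⟨T, ⟨hT, hTS⟩, hxT⟩
  · rintro ⟨T, hT, hx⟩
    exact hT.2 hx

lemma rot_zpow_mapsTo_cyclicCells {n : ℕ} (k : ℤ) {T : Set (OnePoint ℂ)}
    (hT : T ∈ cyclicCells n) : Set.MapsTo (rot n ^ k : Equiv.Perm (OnePoint ℂ)) T T := by
  rw [rot_zpow]
  rcases hT with (rfl | rfl) | ⟨z, -, rfl⟩
  · rintro x rfl
    simp
  · rintro x rfl
    simp
  · rintro x ⟨l, rfl⟩
    refine ⟨k + l, ?_⟩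
    rw [scale_coe, val_expTurnUnit, ← mul_assoc, ← expTurn_add, ← add_div]
    push_cast
    rfl

lemma image_eq_of_mapsTo {X : Type*} {f : Equiv.Perm X} {S : Set X} (h : Set.MapsTo f S S)
    (h' : Set.MapsTo (f⁻¹ : Equiv.Perm X) S S) : f '' S = S :=
  h.image_subset.antisymm fun x hx => ⟨f⁻¹ x, h' hx, by simp⟩

lemma rotGroup_le_linFrac (n : ℕ) : rotGroup n ≤ linFrac := fun f hf => by
  obtain ⟨c, rfl⟩ := exists_eq_scale_of_mem_rotGroup hf
  exact scale_mem_linFrac c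

lemma rotGroup_le_fixGroup_of_isUnionOf {n : ℕ} {α : Set (OnePoint ℂ)}
    (h : IsUnionOf (cyclicCells n) α) : rotGroup n ≤ fixGroup α := by
  rw [rotGroup_eq_zpowers, Subgroup.zpowers_le]
  refine mem_fixGroup.2 ⟨rotGroup_le_linFrac n (rot_mem_rotGroup n), image_eq_of_mapsTo ?_ ?_⟩
  · have := mapsTo_of_isUnionOf h fun T hT => rot_zpow_mapsTo_cyclicCells 1 hT
    rwa [zpow_one] at this
  · have := mapsTo_of_isUnionOf h fun T hT => rot_zpow_mapsTo_cyclicCells (-1) hT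
    rwa [_root_.zpow_neg_one] at this

lemma scale_mem_of_rot_mem {m : ℕ} {S : Set (OnePoint ℂ)} (h : rot m ∈ fixGroup S) (k : ℤ)
    {x : OnePoint ℂ} (hx : x ∈ S) : scale (expTurnUnit (k / m)) x ∈ S := by
  rw [← rot_zpow]
  have := (mem_fixGroup.1 (zpow_mem h k)).2
  have h2 := Set.mem_image_of_mem (rot m ^ k : Equiv.Perm (OnePoint ℂ)) hx
  rwa [this] at h2

lemma isUnionOf_cyclicCells {n : ℕ} {α : Set (OnePoint ℂ)} (h : rot n ∈ fixGroup α) :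
    IsUnionOf (cyclicCells n) α := by
  refine isUnionOf_of_forall fun x hx => ?_
  cases x with
  | infty => exact ⟨{∞}, Or.inl (Or.inl rfl), rfl, by simpa using hx⟩
  | coe z =>
    by_cases hz : z = 0
    · subst hz
      exact ⟨{((0 : ℂ) : OnePoint ℂ)}, Or.inl (Or.inr rfl), rfl, by simpa using hx⟩
    · refine ⟨cyclicOrbit n z, Or.inr ⟨z, hz, rfl⟩, ⟨0, by simp [expTurn_zero]⟩, ?_⟩
      rintro w ⟨k, rfl⟩
      exact scale_mem_of_rot_mem h k hx

/-! ### The dihedral case -/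

/-- The cells are the orbits of the group generated by `rot m` and `inversion`, so each point of an
invariant set lies in a cell contained in the set. -/
lemma isUnionOf_dihedralCells {m : ℕ} (hm : m ≠ 0) {S : Set (OnePoint ℂ)}
    (h : rot m ∈ fixGroup S) (hinv : inversion ∈ fixGroup S) : IsUnionOf (dihedralCells m) S := by
  have hm' : (m : ℝ) ≠ 0 := Nat.cast_ne_zero.2 hm
  have hi : ∀ x ∈ S, inversion x ∈ S := fun x hx => by
    have := Set.mem_image_of_mem inversion hx
    rwa [(mem_fixGroup.1 hinv).2] at this
  refine isUnionOf_of_forall fun x hx => ?_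
  have h0 : x = ((0 : ℂ) : OnePoint ℂ) ∨ x = ∞ →
      ∃ T ∈ dihedralCells m, x ∈ T ∧ T ⊆ S := by
    intro hx0
    refine ⟨{((0 : ℂ) : OnePoint ℂ), ∞}, Or.inl (Or.inl rfl), by simpa using hx0, ?_⟩
    have h1 := hi x hx
    rcases hx0 with rfl | rfl
    · rw [inversion_zero] at h1
      exact Set.insert_subset hx (Set.singleton_subset_iff.2 h1)
    · rw [inversion_infty] at h1
      exact Set.insert_subset h1 (Set.singleton_subset_iff.2 hx)
  cases x with
  | infty => exact h0 (Or.inr rfl)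
  | coe z =>
    by_cases hz : z = 0
    · exact h0 (Or.inl (by rw [hz]))
    by_cases hl : ∃ l : ℤ, z = expTurn (l / (2 * m))
    · obtain ⟨l, rfl⟩ := hl
      -- Among the 2m-th roots of unity, even exponents form `dihedralA` and odd ones `dihedralB`.
      rcases Int.even_or_odd' l with ⟨j, rfl | rfl⟩
      · refine ⟨dihedralA m, Or.inl (Or.inr (Or.inl rfl)), ⟨j, ?_⟩, ?_⟩
        · congr 2
          push_cast
          field_simp
        · rintro w ⟨k, rfl⟩
          convert scale_mem_of_rot_mem h (k - j) hx using 1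
          rw [scale_coe, val_expTurnUnit, ← expTurn_add]
          congr 2
          push_cast
          field_simp
          ring
      · refine ⟨dihedralB m, Or.inl (Or.inr (Or.inr rfl)), ⟨j, ?_⟩, ?_⟩
        · push_cast
          rfl
        · rintro w ⟨k, rfl⟩
          convert scale_mem_of_rot_mem h (k - j) hx using 1
          rw [scale_coe, val_expTurnUnit, ← expTurn_add]
          congr 2
          push_cast
          field_simp
          ring
    · push Not at hl
      refine ⟨dihedralC m z, Or.inr ⟨z, hz, hl, rfl⟩, Or.inl ⟨0, by simp [expTurn_zero]⟩, ?_⟩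
      rintro w (⟨k, rfl⟩ | ⟨k, rfl⟩)
      · convert scale_mem_of_rot_mem h k hx using 1
        rw [scale_coe, val_expTurnUnit, mul_comm]
      · convert scale_mem_of_rot_mem h k (hi _ hx) using 1
        rw [inversion_coe hz, scale_coe, val_expTurnUnit, mul_comm]

lemma dihedralCase_of_conj_mem {α : Set (OnePoint ℂ)} [Finite (fixGroup α)]
    {ψ : Equiv.Perm (OnePoint ℂ)} (hψ : ψ ∈ linFrac) {c : ℂˣ} (hc1 : c ≠ 1)
    (hc : ψ⁻¹ * scale c * ψ ∈ fixGroup α) (hi : ψ⁻¹ * inversion * ψ ∈ fixGroup α) :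
    DihedralCase α := by
  have hfin : IsOfFinOrder c := by
    have h1 : IsOfFinOrder (ψ⁻¹ * scale c * ψ) :=
      Submonoid.isOfFinOrder_coe.2 (isOfFinOrder_of_finite (⟨_, hc⟩ : fixGroup α))
    obtain ⟨k, hk, h⟩ := isOfFinOrder_iff_pow_eq_one.1 h1
    refine isOfFinOrder_iff_pow_eq_one.2 ⟨k, hk, scale_injective ?_⟩
    have h2 := conj_pow (i := k) (a := ψ⁻¹) (b := scale c)
    rw [inv_inv, h] at h2
    have h3 : ψ⁻¹ * scale c ^ k * (ψ⁻¹)⁻¹ = 1 := by rw [inv_inv, ← h2]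
    rw [map_pow, conj_eq_one_iff.1 h3, map_one]
  rw [conj_mem_fixGroup_iff hψ] at hc hi
  -- The scalar c is some primitive root of unity; a power of it is the standard one.
  obtain ⟨k, hk⟩ := exists_pow_eq_expTurnUnit hfin
  have h2 : 2 ≤ orderOf c := by
    have := hfin.orderOf_pos
    have : orderOf c ≠ 1 := fun e => hc1 (orderOf_eq_one_iff.1 e)
    omega
  refine ⟨orderOf c, h2, ψ, hψ, isUnionOf_dihedralCells (by omega) ?_ hi⟩
  rw [rot_eq_scale, ← hk, map_pow]
  exact pow_mem hc k

/-- The case in which the stabilizer of `α` is one of the standard cyclic groups. -/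
lemma exists_fixGroup_eq_rotGroup {n : ℕ} (hn : 2 ≤ n) {α : Set (OnePoint ℂ)} (hα : α.Finite)
    (h3 : 3 ≤ α.ncard) (hle : rotGroup n ≤ fixGroup α) (hd : ¬ DihedralCase α) :
    ∃ N, fixGroup α = rotGroup N ∧ N ≠ 0 := by
  have := finite_fixGroup hα h3
  have hrot1 : expTurnUnit (1 / n) ≠ 1 := fun e => by
    have h := (isPrimitiveRoot_expTurnUnit (n := n) (by omega)).eq_orderOf
    rw [e, orderOf_one] at h
    omega
  have hrot : scale (expTurnUnit (1 / n)) ∈ fixGroup α := hle (rot_mem_rotGroup n)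
  obtain ⟨p, q, hpq, h⟩ := exists_common_fixed (fixGroup_le_linFrac α)
    (fun e => hrot1 (scale_injective (by
      rw [e] at hrot
      rw [map_one, Subgroup.mem_bot.1 hrot])))
    (fun s hs t ht hs1 ht1 hss htt => by
      by_contra hst
      obtain ⟨ψ, hψ, c, hc1, hc, hi⟩ := exists_conj_dihedral (fixGroup_le_linFrac α) hs ht hs1 ht1
        hss htt hst
      exact hd (dihedralCase_of_conj_mem hψ hc1 hc hi))
  -- The common fixed points are fixed by the rotation of order n, so they are 0 and ∞.
  have hp := (scale_eq_self_iff hrot1 p).1 (h _ hrot).1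
  have hq := (scale_eq_self_iff hrot1 q).1 (h _ hrot).2
  refine ⟨Nat.card (fixGroup α), eq_rotGroup_of_forall_scale fun f hf => ?_, Nat.card_pos.ne'⟩
  have hf' := h f hf
  rcases hp with rfl | rfl <;> rcases hq with rfl | rfl
  · exact absurd rfl hpq
  · exact eq_scale_of_fixes (fixGroup_le_linFrac α hf) hf'.1 hf'.2
  · exact eq_scale_of_fixes (fixGroup_le_linFrac α hf) hf'.2 hf'.1
  · exact absurd rfl hpq

/-- Two distinct involutions cannot both preserve an image of a set with cyclic stabilizer. -/
lemma fixGroup_ne_rotGroup {n : ℕ} {α : Set (OnePoint ℂ)} {ψ s t : Equiv.Perm (OnePoint ℂ)}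
    (hψ : ψ ∈ linFrac) (hs : s ∈ linFrac) (ht : t ∈ linFrac) (hs1 : s ≠ 1) (ht1 : t ≠ 1)
    (hss : s * s = 1) (htt : t * t = 1) (hst : s ≠ t) (hsα : Set.MapsTo s (ψ '' α) (ψ '' α))
    (htα : Set.MapsTo t (ψ '' α) (ψ '' α)) : fixGroup α ≠ rotGroup n := by
  intro hG
  -- Conjugated back by `ψ`, any such involution is a scaling of order two, and z ↦ -z is the only
  -- one.
  have key : ∀ f ∈ linFrac, f ≠ 1 → f * f = 1 → Set.MapsTo f (ψ '' α) (ψ '' α) →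
      ψ⁻¹ * f * ψ = scale (-1) := by
    intro f hf hf1 hff hfα
    have hfi : f⁻¹ = f := inv_eq_of_mul_eq_one_left hff
    have hmem : ψ⁻¹ * f * ψ ∈ fixGroup α := (conj_mem_fixGroup_iff hψ).2
      (mem_fixGroup.2 ⟨hf, image_eq_of_mapsTo hfα (by rwa [hfi])⟩)
    rw [hG] at hmem
    obtain ⟨c, hc⟩ := exists_eq_scale_of_mem_rotGroup hmem
    have hf' : f = ψ * scale c * ψ⁻¹ := by rw [← hc]; group
    rw [hc, units_eq_neg_one (c := c)]
    · refine scale_injective ?_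
      rw [map_mul, map_one, ← sq]
      rw [hf', ← sq, conj_pow, conj_eq_one_iff] at hff
      exact hff
    · rintro rfl
      exact hf1 (by simp [hf'])
  have := (key s hs hs1 hss hsα).trans (key t ht ht1 htt htα).symm
  exact hst (by simpa using this)

lemma scale_mul_inversion_ne_one (c : ℂˣ) : scale c * inversion ≠ 1 := fun e => by
  have := congrArg (fun f : Equiv.Perm (OnePoint ℂ) => f ∞) e
  simp at this

lemma fixGroup_ne_rotGroup_of_dihedralCase {n : ℕ} {α : Set (OnePoint ℂ)} (h : DihedralCase α) :
    fixGroup α ≠ rotGroup n := by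
  obtain ⟨m, hm, ψ, hψ, hU⟩ := h
  have hm' : (m : ℝ) ≠ 0 := Nat.cast_ne_zero.2 (by omega)
  have hmaps : ∀ k : ℤ, Set.MapsTo (scale (expTurnUnit (k / m)) * inversion) (ψ '' α) (ψ '' α) := by
    intro k
    refine mapsTo_of_isUnionOf hU fun T hT => ?_
    rcases hT with (rfl | rfl | rfl) | ⟨z, hz, -, rfl⟩
    · rintro x (rfl | rfl)
      · simp
      · simp
    · rintro x ⟨l, rfl⟩
      refine ⟨k - l, ?_⟩
      rw [Equiv.Perm.mul_apply, inversion_coe (expTurn_ne_zero _), scale_coe, val_expTurnUnit,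
        ← expTurn_neg, ← expTurn_add]
      congr 2
      push_cast
      ring
    · rintro x ⟨l, rfl⟩
      -- The shift by one comes from 2k - (2l + 1) = 2(k - l - 1) + 1.
      refine ⟨k - l - 1, ?_⟩
      rw [Equiv.Perm.mul_apply, inversion_coe (expTurn_ne_zero _), scale_coe, val_expTurnUnit,
        ← expTurn_neg, ← expTurn_add]
      congr 2
      push_cast
      field_simp
      ring
    · have hw : ∀ (w : ℂ) (l : ℤ), w ≠ 0 →
          (scale (expTurnUnit (k / m)) * inversion) ((w * expTurn (l / m) : ℂ) : OnePoint ℂ) =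
            ((w⁻¹ * expTurn ((k - l : ℤ) / m) : ℂ) : OnePoint ℂ) := by
        intro w l hw
        rw [Equiv.Perm.mul_apply, inversion_coe (mul_ne_zero hw (expTurn_ne_zero _)), scale_coe,
          val_expTurnUnit, mul_inv, ← expTurn_neg, mul_left_comm, ← expTurn_add]
        congr 3
        push_cast
        ring
      rintro x (⟨l, rfl⟩ | ⟨l, rfl⟩)
      · exact Or.inr ⟨k - l, hw z l hz⟩
      · exact Or.inl ⟨k - l, by rw [hw _ l (inv_ne_zero hz), inv_inv]⟩
  refine fixGroup_ne_rotGroup hψ (mul_mem (scale_mem_linFrac _) inversion_mem_linFrac)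
    (mul_mem (scale_mem_linFrac _) inversion_mem_linFrac) (scale_mul_inversion_ne_one _)
    (scale_mul_inversion_ne_one _) (scale_mul_inversion_sq _) (scale_mul_inversion_sq _) ?_
    (hmaps 0) (hmaps 1)
  -- The reflections for k = 0 and k = 1 differ because m ≥ 2.
  intro e
  have h1 := scale_injective (mul_right_cancel e)
  have h2 := (isPrimitiveRoot_expTurnUnit (n := m) (by omega)).eq_orderOf
  rw [Int.cast_zero, zero_div, expTurnUnit_zero, Int.cast_one] at h1
  rw [← h1, orderOf_one] at h2
  omega

/-! ### The polyhedral cases -/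

/-- Products of vectors are coordinatewise, so d with `d * d = 1` acts as a diagonal matrix of
signs; this spares matrices for the half-turns. -/
lemma mul_dotProduct_comm (d u v : Fin 3 → ℝ) : (d * u) ⬝ᵥ v = u ⬝ᵥ (d * v) :=
  Finset.sum_congr rfl fun i _ => by simp only [Pi.mul_apply]; ring

lemma mul_dotProduct_mul {d : Fin 3 → ℝ} (hd : d * d = 1) (u v : Fin 3 → ℝ) :
    (d * u) ⬝ᵥ (d * v) = u ⬝ᵥ v := by
  rw [mul_dotProduct_comm, ← mul_assoc, hd, one_mul]

lemma centralProj_mul {d : Fin 3 → ℝ} (hd : d * d = 1) (v : Fin 3 → ℝ) :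
    centralProj (d * v) = d * centralProj v := by
  rw [centralProj, centralProj, mul_dotProduct_mul hd, mul_smul_comm]

lemma mean_image_mul {d : Fin 3 → ℝ} (hd : d * d = 1) (F : Finset (Fin 3 → ℝ)) :
    mean (F.image (d * ·)) = d * mean F := by
  have hinj : Function.Injective (fun v : Fin 3 → ℝ => d * v) := fun u v h => by
    have := congrArg (d * ·) h
    simpa only [← mul_assoc, hd, one_mul] using this
  rw [mean, mean, Finset.card_image_of_injective _ hinj, Finset.sum_image hinj.injOn,
    mul_smul_comm, Finset.mul_sum]

lemma card_image_mul {d : Fin 3 → ℝ} (hd : d * d = 1) (F : Finset (Fin 3 → ℝ)) :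
    (F.image (d * ·)).card = F.card :=
  Finset.card_image_of_injective _ fun u v h => by
    have := congrArg (d * ·) h
    simpa only [← mul_assoc, hd, one_mul] using this

lemma isSupported_image_mul {P : Set (Fin 3 → ℝ)} {d : Fin 3 → ℝ} (hd : d * d = 1)
    (hP : ∀ v ∈ P, d * v ∈ P) {F : Finset (Fin 3 → ℝ)} (hF : IsSupported P F) :
    IsSupported P (F.image (d * ·)) := by
  obtain ⟨u, c, hu, hc, he⟩ := hF
  have hdd : ∀ v : Fin 3 → ℝ, d * (d * v) = v := fun v => by rw [← mul_assoc, hd, one_mul]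
  refine ⟨d * u, c, fun h => hu ?_, fun v hv => ?_, ?_⟩
  · rw [← hdd u, h, mul_zero]
  · rw [mul_dotProduct_comm]
    exact hc _ (hP v hv)
  · ext v
    rw [Finset.coe_image, he]
    constructor
    · rintro ⟨w, ⟨hw, hwc⟩, rfl⟩
      exact ⟨hP w hw, by rw [mul_dotProduct_mul hd, hwc]⟩
    · rintro ⟨hv, hvc⟩
      exact ⟨d * v, ⟨hP v hv, by rw [← mul_dotProduct_comm, hvc]⟩, hdd v⟩

/-- Vertices, faces and edges are determined by `P` and the dot product, so a symmetry permutes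
them; on an orbit, compose with `diagonal d`, a rotation by `hdet`. -/
lemma mapsTo_polyhedralCells {P : Set (Fin 3 → ℝ)} {d : Fin 3 → ℝ} (hd : d * d = 1)
    (hdet : ∏ i, d i = 1) (hP : ∀ v ∈ P, d * v ∈ P) {T : Set (Fin 3 → ℝ)}
    (hT : T ∈ polyhedralCells P) : Set.MapsTo (d * ·) T T := by
  rcases hT with (rfl | rfl | rfl) | ⟨X, -, rfl⟩
  · rintro x ⟨v, hv, rfl⟩
    exact ⟨d * v, hP v hv, centralProj_mul hd v⟩
  · rintro x ⟨F, hF, h3, rfl⟩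
    exact ⟨F.image (d * ·), isSupported_image_mul hd hP hF, by rwa [card_image_mul hd],
      by rw [mean_image_mul hd, centralProj_mul hd]⟩
  · rintro x ⟨F, hF, h2, rfl⟩
    exact ⟨F.image (d * ·), isSupported_image_mul hd hP hF, by rwa [card_image_mul hd],
      by rw [mean_image_mul hd, centralProj_mul hd]⟩
  · have hmv : ∀ v, diagonal d *ᵥ v = d * v := fun v => funext fun i => mulVec_diagonal d v i
    rintro x ⟨R, hR, hRP, rfl⟩
    refine ⟨diagonal d * R, mul_mem ?_ hR, ?_, ?_⟩
    · rw [mem_specialOrthogonalGroup_iff, mem_orthogonalGroup_iff]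
      refine ⟨?_, by rw [det_diagonal, hdet]⟩
      rw [diagonal_transpose, diagonal_mul_diagonal]
      exact (congrArg diagonal hd).trans diagonal_one
    · have : (fun v => (diagonal d * R) *ᵥ v) = (d * ·) ∘ (fun v => R *ᵥ v) := by
        funext v
        rw [Function.comp_apply, ← hmv, mulVec_mulVec]
      rw [this, Set.image_comp, hRP]
      refine Set.Subset.antisymm (Set.image_subset_iff.2 hP) fun v hv => ⟨d * v, hP v hv, ?_⟩
      change d * (d * v) = v
      rw [← mul_assoc, hd, one_mul]
    · change d * R *ᵥ X = _
      rw [← hmv, mulVec_mulVec]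

lemma centralProj_mem_sphere2 {v : Fin 3 → ℝ} (hv : v ≠ 0) : centralProj v ∈ sphere2 := by
  have h0 : 0 < v ⬝ᵥ v :=
    lt_of_le_of_ne (Finset.sum_nonneg fun i _ => mul_self_nonneg _)
      fun e => hv (dotProduct_self_eq_zero.1 e.symm)
  change centralProj v ⬝ᵥ centralProj v = 1
  rw [centralProj, smul_dotProduct, dotProduct_smul, smul_eq_mul, smul_eq_mul, ← mul_assoc,
    ← mul_inv, Real.mul_self_sqrt h0.le, inv_mul_cancel₀ h0.ne']

/-- The vector of signs of the half-turn about the third axis. -/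
def halfTurnZ : Fin 3 → ℝ := ![-1, -1, 1]

/-- The vector of signs of the half-turn about the first axis. -/
def halfTurnX : Fin 3 → ℝ := ![1, -1, -1]

lemma halfTurnZ_mul_self : halfTurnZ * halfTurnZ = 1 := by
  ext i
  fin_cases i <;> simp [halfTurnZ]

lemma halfTurnX_mul_self : halfTurnX * halfTurnX = 1 := by
  ext i
  fin_cases i <;> simp [halfTurnX]

/-- The facts about the three polyhedra that are needed: the vertex set is invariant under the
half-turns about the axes, contains `(1, 1, 1)` and does not contain the origin. -/
structure IsKleinSymmetric (P : Set (Fin 3 → ℝ)) : Prop where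
  halfTurnZ_mul : ∀ v ∈ P, halfTurnZ * v ∈ P
  halfTurnX_mul : ∀ v ∈ P, halfTurnX * v ∈ P
  ones_mem : ![1, 1, 1] ∈ P
  ne_zero : ∀ v ∈ P, v ≠ 0

/-- If the mean were 0, the supporting plane would pass through the origin. The four images of (1,
1, 1) under the Klein group sum to 0 and span the space, so a functional u that is nonpositive on
all of them vanishes. -/
lemma IsKleinSymmetric.mean_ne_zero {P : Set (Fin 3 → ℝ)} (hP : IsKleinSymmetric P)
    {F : Finset (Fin 3 → ℝ)} (hF : IsSupported P F) (hne : 0 < F.card) : mean F ≠ 0 := by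
  obtain ⟨u, c, hu, hc, he⟩ := hF
  have hsum : u ⬝ᵥ mean F = c := by
    have h1 : ∀ v ∈ F, u ⬝ᵥ v = c := fun v hv => by
      have : v ∈ (F : Set (Fin 3 → ℝ)) := hv
      rw [he] at this
      exact this.2
    rw [mean, dotProduct_smul, dotProduct_sum, Finset.sum_congr rfl h1, Finset.sum_const,
      nsmul_eq_mul, smul_eq_mul, inv_mul_cancel_left₀ (Nat.cast_ne_zero.2 hne.ne')]
  intro h0
  rw [h0, dotProduct_zero] at hsum
  subst hsum
  have e1 := hc _ hP.ones_mem
  have e2 := hc _ (hP.halfTurnZ_mul _ hP.ones_mem)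
  have e3 := hc _ (hP.halfTurnX_mul _ hP.ones_mem)
  have e4 := hc _ (hP.halfTurnX_mul _ (hP.halfTurnZ_mul _ hP.ones_mem))
  simp only [dotProduct, Fin.sum_univ_three, halfTurnZ, halfTurnX, Pi.mul_apply, cons_val_zero,
    cons_val_one, cons_val] at e1 e2 e3 e4
  apply hu
  ext i
  fin_cases i <;> simp <;> linarith

lemma IsKleinSymmetric.subset_sphere2 {P : Set (Fin 3 → ℝ)} (hP : IsKleinSymmetric P)
    {T : Set (Fin 3 → ℝ)} (hT : T ∈ polyhedralCells P) : T ⊆ sphere2 := by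
  rcases hT with (rfl | rfl | rfl) | ⟨X, hX, rfl⟩
  · rintro x ⟨v, hv, rfl⟩
    exact centralProj_mem_sphere2 (hP.ne_zero v hv)
  · rintro x ⟨F, hF, h3, rfl⟩
    exact centralProj_mem_sphere2 (hP.mean_ne_zero hF (by omega))
  · rintro x ⟨F, hF, h2, rfl⟩
    exact centralProj_mem_sphere2 (hP.mean_ne_zero hF (by omega))
  · rintro x ⟨R, hR, -, rfl⟩
    have h1 : Rᵀ * R = 1 := by
      have := (mem_orthogonalGroup_iff' (A := R)).1 (mem_specialOrthogonalGroup_iff.1 hR).1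
      exact this
    change (R *ᵥ X) ⬝ᵥ (R *ᵥ X) = 1
    rw [dotProduct_mulVec, ← mulVec_transpose, mulVec_mulVec, h1, one_mulVec]
    exact hX.1

/-! ### Half-turns seen on the Riemann sphere -/

lemma stereo_halfTurnZ (x : Fin 3 → ℝ) : stereo (halfTurnZ * x) = scale (-1) (stereo x) := by
  simp only [stereo, halfTurnZ, Pi.mul_apply, cons_val_zero, cons_val_one, cons_val, one_mul]
  split_ifs
  · simp
  · rw [scale_coe]
    congr 1
    push_cast
    ring

lemma stereo_halfTurnX {x : Fin 3 → ℝ} (hx : x ∈ sphere2) :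
    stereo (halfTurnX * x) = inversion (stereo x) := by
  have hs : x 0 * x 0 + x 1 * x 1 + x 2 * x 2 = 1 := by
    have h : x ⬝ᵥ x = 1 := hx
    simpa [dotProduct, Fin.sum_univ_three] using h
  have hsC : ((x 0 : ℂ) * x 0 + x 1 * x 1 + x 2 * x 2) = 1 := by exact_mod_cast hs
  simp only [stereo, halfTurnX, Pi.mul_apply, cons_val_zero, cons_val_one, cons_val, one_mul]
  by_cases h1 : x 2 = 1
  · have hx0 : x 0 = 0 := by nlinarith [mul_self_nonneg (x 0), mul_self_nonneg (x 1)]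
    have hx1 : x 1 = 0 := by nlinarith [mul_self_nonneg (x 0), mul_self_nonneg (x 1)]
    norm_num [h1, hx0, hx1]
  · by_cases h2 : x 2 = -1
    · have hx0 : x 0 = 0 := by nlinarith [mul_self_nonneg (x 0), mul_self_nonneg (x 1)]
      have hx1 : x 1 = 0 := by nlinarith [mul_self_nonneg (x 0), mul_self_nonneg (x 1)]
      norm_num [h2, hx0, hx1]
    · have h3 : (1 : ℂ) - x 2 ≠ 0 := fun e => h1 (by exact_mod_cast (sub_eq_zero.1 e).symm)
      have h4 : (1 : ℂ) + x 2 ≠ 0 := fun e => h2 (by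
        have : (x 2 : ℂ) = ((-1 : ℝ) : ℂ) := by push_cast; linear_combination e
        exact_mod_cast this)
      -- The sphere equation in factored form: it identifies the inverse of (x₀ + i x₁)/(1 - x₂)
      -- with (x₀ - i x₁)/(1 + x₂).
      have hprod : ((x 0 : ℂ) + x 1 * Complex.I) * (x 0 - x 1 * Complex.I) =
          (1 - x 2) * (1 + x 2) := by
        linear_combination hsC - (x 1 : ℂ) ^ 2 * Complex.I_sq
      have h5 : (x 0 : ℂ) + x 1 * Complex.I ≠ 0 :=
        left_ne_zero_of_mul (hprod ▸ mul_ne_zero h3 h4)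
      rw [if_neg h1, if_neg (fun e => h2 (by linarith)), inversion_coe (div_ne_zero h5 h3), inv_div]
      congr 1
      rw [div_eq_div_iff (by push_cast; simpa using h4) h5]
      push_cast
      linear_combination hprod

lemma scale_neg_one_ne_one : scale (-1) ≠ 1 := fun e => by
  rw [← map_one scale] at e
  have := congrArg Units.val (scale_injective e)
  norm_num at this

lemma IsKleinSymmetric.fixGroup_ne_rotGroup {P : Set (Fin 3 → ℝ)} (hP : IsKleinSymmetric P)
    {n : ℕ} {α : Set (OnePoint ℂ)} (h : PolyhedralCase P α) : fixGroup α ≠ rotGroup n := by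
  obtain ⟨ψ, hψ, S, hS, hα⟩ := h
  have hsub : S ⊆ sphere2 := by
    obtain ⟨𝒯, h𝒯, rfl⟩ := hS
    exact Set.sUnion_subset fun T hT => hP.subset_sphere2 (h𝒯 hT)
  have hne1 : inversion ≠ 1 := by simpa using scale_mul_inversion_ne_one 1
  refine MobiusStab.fixGroup_ne_rotGroup hψ (scale_mem_linFrac (-1)) inversion_mem_linFrac
    scale_neg_one_ne_one hne1 (by rw [← map_mul]; simp) inversion_mul_self ?_ ?_ ?_
  · intro e
    have := congrArg (fun f : Equiv.Perm (OnePoint ℂ) => f ∞) e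
    simp at this
  · rw [hα]
    rintro _ ⟨x, hx, rfl⟩
    refine ⟨halfTurnZ * x, ?_, stereo_halfTurnZ x⟩
    exact mapsTo_of_isUnionOf hS (fun T hT => mapsTo_polyhedralCells halfTurnZ_mul_self
      (by simp [Fin.prod_univ_three, halfTurnZ]) hP.halfTurnZ_mul hT) hx
  · rw [hα]
    rintro _ ⟨x, hx, rfl⟩
    refine ⟨halfTurnX * x, ?_, stereo_halfTurnX (hsub hx)⟩
    exact mapsTo_of_isUnionOf hS (fun T hT => mapsTo_polyhedralCells halfTurnX_mul_self
      (by simp [Fin.prod_univ_three, halfTurnX]) hP.halfTurnX_mul hT) hx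

/-! ### Klein symmetry of the three polyhedra -/

lemma mul_vec3 (d : Fin 3 → ℝ) (x y z : ℝ) : d * ![x, y, z] = ![d 0 * x, d 1 * y, d 2 * z] := by
  ext i
  fin_cases i <;> rfl

lemma isKleinSymmetric_tetrahedron : IsKleinSymmetric tetrahedron where
  halfTurnZ_mul v hv := by
    rcases hv with rfl | rfl | rfl | rfl <;> simp [tetrahedron, halfTurnZ, mul_vec3]
  halfTurnX_mul v hv := by
    rcases hv with rfl | rfl | rfl | rfl <;> simp [tetrahedron, halfTurnX, mul_vec3]
  ones_mem := by simp [tetrahedron]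
  ne_zero v hv h0 := by
    rcases hv with rfl | rfl | rfl | rfl <;> simpa using congrFun h0 0

lemma mul_mem_cube {d v : Fin 3 → ℝ} (hd : d ∈ cube) (hv : v ∈ cube) : d * v ∈ cube := fun i => by
  rcases hd i with h | h <;> rcases hv i with h' | h' <;> simp [h, h']

lemma halfTurnZ_mem_cube : halfTurnZ ∈ cube := fun i => by
  fin_cases i <;> simp [halfTurnZ]

lemma halfTurnX_mem_cube : halfTurnX ∈ cube := fun i => by
  fin_cases i <;> simp [halfTurnX]

lemma isKleinSymmetric_cube : IsKleinSymmetric cube where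
  halfTurnZ_mul _ hv := mul_mem_cube halfTurnZ_mem_cube hv
  halfTurnX_mul _ hv := mul_mem_cube halfTurnX_mem_cube hv
  ones_mem i := by fin_cases i <;> simp
  ne_zero v hv h0 := by
    rcases hv 0 with h | h <;> simp [h0] at h

lemma mul_mem_dodecahedron {d v : Fin 3 → ℝ} (hd : d ∈ cube) (hv : v ∈ dodecahedron) :
    d * v ∈ dodecahedron := by
  have hsign : ∀ i, ∀ a : ℝ, (a = 1 ∨ a = -1) → (d i * a = 1 ∨ d i * a = -1) := by
    intro i a ha
    rcases hd i with h | h <;> rcases ha with rfl | rfl <;> simp [h]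
  rcases hv with hv | ⟨a, b, ha, hb, rfl | rfl | rfl⟩
  · exact Or.inl (mul_mem_cube hd hv)
  · exact Or.inr ⟨d 1 * a, d 2 * b, hsign 1 a ha, hsign 2 b hb, Or.inl (by
      simp [mul_vec3, mul_assoc])⟩
  · exact Or.inr ⟨d 0 * a, d 1 * b, hsign 0 a ha, hsign 1 b hb, Or.inr (Or.inl (by
      simp [mul_vec3, mul_assoc]))⟩
  · exact Or.inr ⟨d 2 * a, d 0 * b, hsign 2 a ha, hsign 0 b hb, Or.inr (Or.inr (by
      simp [mul_vec3, mul_assoc]))⟩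

lemma isKleinSymmetric_dodecahedron : IsKleinSymmetric dodecahedron where
  halfTurnZ_mul _ hv := mul_mem_dodecahedron halfTurnZ_mem_cube hv
  halfTurnX_mul _ hv := mul_mem_dodecahedron halfTurnX_mem_cube hv
  ones_mem := Or.inl isKleinSymmetric_cube.ones_mem
  ne_zero v hv h0 := by
    have hsign : ∀ a : ℝ, (a = 1 ∨ a = -1) → a * Real.goldenRatio ≠ 0 := by
      intro a ha
      exact mul_ne_zero (by rcases ha with rfl | rfl <;> norm_num) Real.goldenRatio_ne_zero
    rcases hv with hv | ⟨a, b, -, hb, rfl | rfl | rfl⟩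
    · exact isKleinSymmetric_cube.ne_zero v hv h0
    · exact hsign b hb (congrFun h0 2)
    · exact hsign b hb (congrFun h0 1)
    · exact hsign b hb (congrFun h0 0)

end MobiusStab

end

/-! ### The main theorem -/

theorem mainTheorem9 (n : ℕ) (hn : 2 ≤ n) :
    Nonempty (MobiusStab.rotGroup n ≃* Multiplicative (ZMod n)) ∧
    (∀ p : ℕ, 2 ≤ p → ∀ z : ℂ, z ≠ 0 →
      MobiusStab.cyclicOrbit (p * n) z =
        ⋃ j ∈ Finset.range p,
          MobiusStab.cyclicOrbit n (MobiusStab.expTurn ((j : ℝ) / ((p : ℝ) * (n : ℝ))) * z)) ∧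
    ∀ α : Set (OnePoint ℂ), α.Finite → 4 ≤ α.ncard →
      (MobiusStab.fixGroup α = MobiusStab.rotGroup n ↔
        MobiusStab.IsUnionOf (MobiusStab.cyclicCells n) α ∧
        (∀ p : ℕ, 2 ≤ p → ¬ MobiusStab.IsUnionOf (MobiusStab.cyclicCells (p * n)) α) ∧
        ¬ (MobiusStab.PolyhedralCase MobiusStab.dodecahedron α ∨
           MobiusStab.PolyhedralCase MobiusStab.cube α ∨
           MobiusStab.PolyhedralCase MobiusStab.tetrahedron α ∨
           MobiusStab.DihedralCase α)) := by
  open MobiusStab in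
  have hn0 : n ≠ 0 := by omega
  refine ⟨nonempty_rotGroup_mulEquiv hn0, fun p hp z _ => cyclicOrbit_mul hn0 (by omega) z,
    fun α hα h4 => ⟨fun hG => ⟨?_, fun p hp hU => ?_, ?_⟩, ?_⟩⟩
  · exact isUnionOf_cyclicCells (hG ▸ rot_mem_rotGroup n)
  -- A group of order pn > n cannot lie in one of order n.
  · have hle := rotGroup_le_fixGroup_of_isUnionOf hU
    rw [hG] at hle
    have hdvd := Subgroup.card_dvd_of_le hle
    rw [card_rotGroup hn0, card_rotGroup (Nat.mul_ne_zero (by omega) hn0)] at hdvd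
    have := Nat.le_of_dvd (by omega) hdvd
    nlinarith
  · rintro (h | h | h | h)
    · exact isKleinSymmetric_dodecahedron.fixGroup_ne_rotGroup h hG
    · exact isKleinSymmetric_cube.fixGroup_ne_rotGroup h hG
    · exact isKleinSymmetric_tetrahedron.fixGroup_ne_rotGroup h hG
    · exact fixGroup_ne_rotGroup_of_dihedralCase h hG
  · rintro ⟨h1, h2, h3⟩
    have hle := rotGroup_le_fixGroup_of_isUnionOf h1
    obtain ⟨N, hN, hN0⟩ := exists_fixGroup_eq_rotGroup hn hα (by omega) hle
      fun h => h3 (Or.inr (Or.inr (Or.inr h)))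
    have hdvd := Subgroup.card_dvd_of_le (hN ▸ hle)
    rw [card_rotGroup hn0, card_rotGroup hN0] at hdvd
    obtain ⟨p, rfl⟩ := hdvd
    rw [mul_comm] at hN hN0
    -- The stabilizer is `rotGroup (p * n)`; if p ≥ 2, its orbits contradict condition 2.
    by_cases hp : 2 ≤ p
    · exact absurd (isUnionOf_cyclicCells (hN ▸ rot_mem_rotGroup _)) (h2 p hp)
    · have hp1 : p = 1 := by
        have : p ≠ 0 := left_ne_zero_of_mul hN0
        omega
      rwa [hp1, one_mul] at hN
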